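/- Let $-1<q<0$, $x=-q$, and $V=\mathbb C v_+\oplus\mathbb C v_-$. Let $\pi_\zeta$ ($\zeta\in\mathbb C\setminus\{0\}$) be the vector representation of $U_q'(\widehat{sl}_2)$ on $V$, for which $\pi_\zeta(f_1)v_+=\zeta^{-1}v_-$, $\pi_\zeta(f_1)v_-=0$, $\pi_\zeta(t_1)v_\pm=q^{\pm1}v_\pm$, and let $\pi_{(\zeta_1,\dots,\zeta_N)}=(\pi_{\zeta_1}\otimes\cdots\otimes\pi_{\zeta_N})\circ\Delta^{(N-1)}$ be the tensor representation, where $\Delta(f_1)=f_1\otimes t_1^{-1}+1\otimes f_1$ and $\Delta(t_1)=t_1\otimes t_1$. Thus $$\pi_{(\zeta_1,\dots,\zeta_N)}(f_1)=\sum_{j=1}^N 1^{\otimes (j-1)}\otimes\pi_{\zeta_j}(f_1)\otimes\pi_{\zeta_{j+1}}(t_1^{-1})\otimes\cdots\otimes\pi_{\zeta_N}(t_1^{-1}).$$ Let $V^{(nl)}\subset V^{\otimes N}$, $N=n+l$, be the span of the $v_{\varepsilon_1}\otimes\cdots\otimes v_{\varepsilon_N}$ with $\sum\varepsilon_i=l-n$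 (the zero space if $n<0$ or $l<0$), and for even $N$ let $D^{(nl)}=q^{-N/2}\,\mathrm{diag}(q^n,q^l)$ in the basis $(v_+,v_-)$. Let $R(\zeta)\in\mathrm{End}(V\otimes V)$ be the $R$-matrix $$R(\zeta)\,v_\pm\otimes v_\pm=v_\pm\otimes v_\pm,\qquad R(\zeta)\,v_\pm\otimes v_\mp=\frac{q(1-\zeta^2)}{1-q^2\zeta^2}\,v_\pm\otimes v_\mp+\frac{(1-q^2)\zeta}{1-q^2\zeta^2}\,v_\mp\otimes v_\pm ,$$ and put $S(\zeta)=S_0(\zeta)R(\zeta)$. Here $S_0$ and $r$ are given scalar functions, and $\varepsilon\in\{1,-1\}$. Subscripts on operators denote the tensor factors in which they act, and $P(x\otimes y)=y\otimes x$. For a diagonal operator $D$ on $V$, an integer $N\ge 2$, and functions $G(\zeta_1,\dots,\zeta_N)\in V^{\otimes N}$ and $G'(\zeta_1,\dots,\zeta_{N-2})\in V^{\otimes (N-2)}$, where $G$ is (single-valued) meromorphic on $(\mathbb C\setminus\{0\})^N$, consider the following axioms (understood for generic values of the variables, i.e. on a dense open set): 1. ($S$-matrix symmetry) for $1\le j\le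 N-1$, $$P_{j\,j+1}G(\dots,\zeta_{j+1},\zeta_j,\dots)=S_{j\,j+1}(\zeta_j/\zeta_{j+1})\,G(\dots,\zeta_j,\zeta_{j+1},\dots).$$ 2. (Deformed cyclicity) $$P_{12}\cdots P_{N-1\,N}\,G(\zeta_2,\dots,\zeta_N,\zeta_1q^{-2})=\varepsilon\, r(\zeta_1)\,D_1\,G(\zeta_1,\dots,\zeta_N).$$ 3. (Annihilation poles) for $\sigma=\pm1$, $G$ has an at most simple pole at $\zeta_N=\sigma\zeta_{N-1}x^{-1}$, with $$\mathrm{Res}_{\zeta_N=\sigma\zeta_{N-1}x^{-1}}G=\tfrac12\Bigl(I-\varepsilon\sigma^{N+1}r(\sigma\zeta_{N-1}x)\,D_N\,S_{N-1,N-2}(\zeta_{N-1}/\zeta_{N-2})\cdots S_{N-1,1}(\zeta_{N-1}/\zeta_1)\Bigr)\,G'(\zeta_1,\dots,\zeta_{N-2})\otimes u_\sigma,$$ where $u_\sigma=v_+\otimes v_-+\sigma\,v_-\otimes v_+$. Theorem. Let $0\le n\le l$ with $N=n+l\geq 2$ even. Let $G_\varepsilon^{(nl)}$, with values in $V^{(nl)}$,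 and $G_\varepsilon^{(n-1\,l-1)}$, with values in $V^{(n-1\,l-1)}$, be such that $G=G_\varepsilon^{(nl)}$ is meromorphic and satisfies axioms 1, 2, 3 with $D=D^{(nl)}$ and $G'=G_\varepsilon^{(n-1\,l-1)}$. Put $$\tilde G_\varepsilon^{(n+1\,l-1)}(\zeta)=\pi_\zeta(f_1)G_\varepsilon^{(nl)}(\zeta),\qquad \tilde G_\varepsilon^{(n\,l-2)}(\zeta')=\pi_{\zeta'}(f_1)G_\varepsilon^{(n-1\,l-1)}(\zeta').$$ Then $\tilde G_\varepsilon^{(n+1\,l-1)}$ and $\tilde G_\varepsilon^{(n\,l-2)}$ take values in $V^{(n+1\,l-1)}$ and $V^{(n\,l-2)}$, and $G=\tilde G_\varepsilon^{(n+1\,l-1)}$ is meromorphic and satisfies axioms 1, 2, 3, with the same $S_0,r,\varepsilon$, with $G'=\tilde G_\varepsilon^{(n\,l-2)}$ and with the diagonal operator $D=D^{(n-1\,l+1)}$. -/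

import Mathlib

open scoped Topology
open Filter

noncomputable section

namespace XXZ

/-- Vectors of `V^{⊗N}`, `V = ℂ v₊ ⊕ ℂ v₋`, through their components in the basis
`v_{s 1} ⊗ ⋯ ⊗ v_{s N}`; the index `0 : Fin 2` stands for `+` and `1 : Fin 2` for `-`. -/
abbrev State (N : ℕ) : Type := (Fin N → Fin 2) → ℂ

/-- Operators on `V^{⊗N}`, as matrices in the same basis. -/
abbrev Op (N : ℕ) : Type := Matrix (Fin N → Fin 2) (Fin N → Fin 2) ℂ

/-- The sign `±1` attached to a basis index. -/
def spin (a : Fin 2) : ℤ := if a = 0 then 1 else -1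

/-- The subspace `V^{(n l)}` of `V^{⊗N}`, `N = n + l`: the span of the basis vectors with
`∑ εᵢ = l - n`. (It is zero if `n < 0` or `l < 0`.) -/
def sector (N : ℕ) (n l : ℤ) : Submodule ℂ (State N) where
  carrier := {v | ∀ s, ∑ i, spin (s i) ≠ l - n → v s = 0}
  add_mem' := by
    intro a b ha hb s hs
    simp [ha s hs, hb s hs]
  zero_mem' := by
    intro s _
    rfl
  smul_mem' := by
    intro c a ha s hs
    simp [ha s hs]

/-- The operator `A₁ ⊗ ⋯ ⊗ A_N` on `V^{⊗N}`. -/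
def tensorOp {N : ℕ} (A : Fin N → Matrix (Fin 2) (Fin 2) ℂ) : Op N :=
  fun s t => ∏ i, A i (s i) (t i)

/-- `A` acting in the `j`-th tensor factor. -/
def siteOp {N : ℕ} (j : Fin N) (A : Matrix (Fin 2) (Fin 2) ℂ) : Op N :=
  tensorOp fun i => if i = j then A else 1

/-- `X ∈ End (V ⊗ V)` acting in the `j`-th (as first) and `k`-th (as second) tensor factors. -/
def pairOp {N : ℕ} (j k : Fin N) (X : Matrix (Fin 2 × Fin 2) (Fin 2 × Fin 2) ℂ) : Op N :=
  fun s t => if ∀ i, i ≠ j → i ≠ k → s i = t i then X (s j, s k) (t j, t k) else 0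

/-- `π_ζ(f₁)`: `v₊ ↦ ζ⁻¹ v₋`, `v₋ ↦ 0`. -/
def vecF1 (ζ : ℂ) : Matrix (Fin 2) (Fin 2) ℂ := !![0, 0; ζ⁻¹, 0]

/-- `π_ζ(t₁⁻¹)`: `v₊ ↦ q⁻¹ v₊`, `v₋ ↦ q v₋`. -/
def vecT1inv (q : ℂ) : Matrix (Fin 2) (Fin 2) ℂ := !![q⁻¹, 0; 0, q]

/-- The tensor representation `π_{(ζ₁, …, ζ_N)}(f₁) = (π_{ζ₁} ⊗ ⋯ ⊗ π_{ζ_N}) (Δ^{(N-1)}(f₁))`.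
For the coproduct `Δ(f₁) = f₁ ⊗ t₁⁻¹ + 1 ⊗ f₁`, `Δ(t₁) = t₁ ⊗ t₁` one has
`Δ^{(N-1)}(f₁) = ∑ⱼ 1 ⊗ ⋯ ⊗ 1 ⊗ f₁ ⊗ t₁⁻¹ ⊗ ⋯ ⊗ t₁⁻¹` with `f₁` in the `j`-th place. -/
def tensorF1 {N : ℕ} (q : ℂ) (ζ : Fin N → ℂ) : Op N :=
  ∑ j, tensorOp fun i => if i < j then 1 else if i = j then vecF1 (ζ j) else vecT1inv q

/-- The `R`-matrix of the XXZ model (the six-vertex `R`-matrix, with `v₊ ⊗ v₊ ↦ v₊ ⊗ v₊`),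
the intertwiner `R(ζ₁/ζ₂) (π_{ζ₁} ⊗ π_{ζ₂}) Δ(y) = (π_{ζ₁} ⊗ π_{ζ₂}) Δ'(y) R(ζ₁/ζ₂)`. -/
def rMatrix (q ζ : ℂ) : Matrix (Fin 2 × Fin 2) (Fin 2 × Fin 2) ℂ :=
  fun a b =>
    if a = b then
      if a.1 = a.2 then 1 else q * (1 - ζ ^ 2) / (1 - q ^ 2 * ζ ^ 2)
    else if a = b.swap then (1 - q ^ 2) * ζ / (1 - q ^ 2 * ζ ^ 2)
    else 0

/-- The `S`-matrix `S(ζ) = S₀(ζ) R(ζ)` with scalar factor `S₀`. -/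
def sMatrix (q : ℂ) (S₀ : ℂ → ℂ) (ζ : ℂ) : Matrix (Fin 2 × Fin 2) (Fin 2 × Fin 2) ℂ :=
  S₀ ζ • rMatrix q ζ

/-- `D^{(n l)} = q^{-N/2} diag(q^n, q^l)`, where `N = n + l` is even. -/
def diagD (q : ℂ) (n l : ℤ) : Matrix (Fin 2) (Fin 2) ℂ :=
  q ^ (-((n + l) / 2)) • Matrix.diagonal ![q ^ n, q ^ l]

/-- The transposition `P_{j k}` of the `j`-th and `k`-th tensor factors. -/
def swapState {N : ℕ} (j k : Fin N) (v : State N) : State N :=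
  fun s => v (s ∘ Equiv.swap j k)

/-- The sequence `(a₂, …, a_N, b)` for `a = (a₁, …, a_N)`. -/
def shiftWith {α : Type*} {N : ℕ} (a : Fin (N + 1) → α) (b : α) : Fin (N + 1) → α :=
  Fin.snoc (α := fun _ => α) (fun i : Fin N => a i.succ) b

/-- The operator `P_{12} P_{23} ⋯ P_{N-1 N}`, which maps
`x₁ ⊗ ⋯ ⊗ x_N` to `x_N ⊗ x₁ ⊗ ⋯ ⊗ x_{N-1}`. -/
def cycleState {N : ℕ} (v : State (N + 1)) : State (N + 1) :=
  fun s => v (shiftWith s (s 0))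

/-- `u_σ = v₊ ⊗ v₋ + σ v₋ ⊗ v₊`, through its components. -/
def uVec (σ : ℂ) (a b : Fin 2) : ℂ :=
  if a = 0 ∧ b = 1 then 1 else if a = 1 ∧ b = 0 then σ else 0

/-- The vector `v ⊗ u_σ` of `V^{⊗(M+2)}` for `v ∈ V^{⊗M}`. -/
def tensorU {M : ℕ} (v : State M) (σ : ℂ) : State (M + 2) :=
  fun s => v (fun i => s i.castSucc.castSucc) *
    uVec σ (s (Fin.last M).castSucc) (s (Fin.last (M + 1)))

/-- The index of the `(N-1)`-st tensor factor, `N = M + 2`. -/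
def penult (M : ℕ) : Fin (M + 2) := (Fin.last M).castSucc

/-- `S_{N-1,N-2}(ζ_{N-1}/ζ_{N-2}) ⋯ S_{N-1,1}(ζ_{N-1}/ζ₁)` on `V^{⊗N}`, `N = M + 2`,
as a function of `(ζ₁, …, ζ_{N-1})`. -/
def sString {M : ℕ} (q : ℂ) (S₀ : ℂ → ℂ) (ζ : Fin (M + 1) → ℂ) : Op (M + 2) :=
  (List.ofFn fun k : Fin M =>
    pairOp (penult M) k.castSucc.castSucc
      (sMatrix q S₀ (ζ (Fin.last M) / ζ k.castSucc))).reverse.prod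

/-- `P` holds for generic `ζ`, that is, on a dense open set. For two meromorphic functions,
being equal at generic points is the same as being equal as meromorphic functions. -/
def Generically {N : ℕ} (P : (Fin N → ℂ) → Prop) : Prop :=
  Dense (interior {ζ | P ζ})

/-- `f` is a (single-valued) meromorphic function of `ζ ∈ (ℂ ∖ {0})^N`: locally it is a quotient
`A / B` of analytic functions, with `B` not locally zero. The values of `f` on the zero set of
the denominator do not matter. -/
def MeromorphicOnTorus {N : ℕ} (f : (Fin N → ℂ) → State N) : Prop :=
  ∀ ζ₀ : Fin N → ℂ, (∀ i, ζ₀ i ≠ 0) →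
    ∃ (A : (Fin N → ℂ) → State N) (B : (Fin N → ℂ) → ℂ),
      AnalyticAt ℂ A ζ₀ ∧ AnalyticAt ℂ B ζ₀ ∧ (¬ ∀ᶠ ζ in 𝓝 ζ₀, B ζ = 0) ∧
      ∀ᶠ ζ in 𝓝 ζ₀, B ζ ≠ 0 → B ζ • f ζ = A ζ

/-- `f` has at `a` an (at most) simple pole, with residue `R`. -/
def HasSimplePole {N : ℕ} (f : ℂ → State N) (a : ℂ) (R : State N) : Prop :=
  MeromorphicAt f a ∧ Tendsto (fun w => (w - a) • f w) (𝓝[≠] a) (𝓝 R)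

/-- `S`-matrix symmetry:
`P_{j j+1} G(…, ζ_{j+1}, ζ_j, …) = S_{j j+1}(ζ_j/ζ_{j+1}) G(…, ζ_j, ζ_{j+1}, …)`. -/
def SMatrixSymmetry {M : ℕ} (q : ℂ) (S₀ : ℂ → ℂ)
    (G : (Fin (M + 2) → ℂ) → State (M + 2)) : Prop :=
  ∀ j : Fin (M + 1), Generically fun ζ : Fin (M + 2) → ℂ =>
    swapState j.castSucc j.succ (G (ζ ∘ Equiv.swap j.castSucc j.succ)) =
      (pairOp j.castSucc j.succ (sMatrix q S₀ (ζ j.castSucc / ζ j.succ))).mulVec (G ζ)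

/-- Deformed cyclicity:
`P_{12} ⋯ P_{N-1 N} G(ζ₂, …, ζ_N, ζ₁ q⁻²) = ε r(ζ₁) D₁ G(ζ₁, …, ζ_N)`. -/
def DeformedCyclicity {M : ℕ} (q : ℂ) (r : ℂ → ℂ) (ε : ℂ) (D : Matrix (Fin 2) (Fin 2) ℂ)
    (G : (Fin (M + 2) → ℂ) → State (M + 2)) : Prop :=
  Generically fun ζ : Fin (M + 2) → ℂ =>
    cycleState (G (shiftWith ζ (ζ 0 * q ^ (-2 : ℤ)))) =
      (ε * r (ζ 0)) • (siteOp 0 D).mulVec (G ζ)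

/-- Annihilation pole condition, with `x = -q` and `N = M + 2`: for `σ = ±1` and generic
`(ζ₁, …, ζ_{N-1})`, the function `ζ_N ↦ G(ζ₁, …, ζ_N)` has a simple pole at
`ζ_N = σ ζ_{N-1} x⁻¹`, with residue
`½ (I - ε σ^{N+1} r(σ ζ_{N-1} x) D_N S_{N-1,N-2}(ζ_{N-1}/ζ_{N-2}) ⋯ S_{N-1,1}(ζ_{N-1}/ζ₁))
  (G'(ζ₁, …, ζ_{N-2}) ⊗ u_σ)`. -/
def AnnihilationPole {M : ℕ} (q : ℂ) (S₀ r : ℂ → ℂ) (ε : ℂ) (D : Matrix (Fin 2) (Fin 2) ℂ)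
    (G : (Fin (M + 2) → ℂ) → State (M + 2)) (G' : (Fin M → ℂ) → State M) : Prop :=
  ∀ σ : ℂ, σ = 1 ∨ σ = -1 → Generically fun ζ : Fin (M + 1) → ℂ =>
    HasSimplePole (fun w => G (Fin.snoc (α := fun _ => ℂ) ζ w))
      (σ * ζ (Fin.last M) * (-q)⁻¹)
      ((1 / 2 : ℂ) •
        ((1 : Op (M + 2)) -
          (ε * σ ^ (M + 3) * r (σ * ζ (Fin.last M) * (-q))) •
            (siteOp (Fin.last (M + 1)) D * sString q S₀ ζ)).mulVec
          (tensorU (G' (fun k => ζ k.castSucc)) σ))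

/-- The `N`-particle function `G`, `N = M + 2`, is meromorphic and satisfies the three axioms of
form factors with scalar functions `S₀`, `r`, sign `ε` and diagonal operator `D`, where `G'` is
the `(N-2)`-particle function which occurs in the residues of `G`. -/
structure IsFormFactor {M : ℕ} (q : ℂ) (S₀ r : ℂ → ℂ) (ε : ℂ) (D : Matrix (Fin 2) (Fin 2) ℂ)
    (G : (Fin (M + 2) → ℂ) → State (M + 2)) (G' : (Fin M → ℂ) → State M) : Prop where
  meromorphic : MeromorphicOnTorus G
  symmetry : SMatrixSymmetry q S₀ G
  cyclicity : DeformedCyclicity q r ε D G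
  poles : AnnihilationPole q S₀ r ε D G G'

/-- `π_ζ(f₁) G(ζ)`. -/
def actF1 {N : ℕ} (q : ℂ) (G : (Fin N → ℂ) → State N) : (Fin N → ℂ) → State N :=
  fun ζ => (tensorF1 q ζ).mulVec (G ζ)

end XXZ

end

noncomputable section

namespace XXZ

open Function
open scoped Kronecker

/-! Each axiom survives because `f₁` can be moved through every operator in it. `lowerOp` writes the
iterated coproduct of `f₁` for an arbitrary order of the tensor factors; only the relative order
given by `ρ` matters. The intertwining property of `R` then says that `S` on two adjacent factors
exchanges their order (`pairOp_mul_lowerOp`), which gives axiom 1.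

In axiom 2 the first factor becomes the last one. Terms with `f₁` in another factor acquire a `t₁⁻¹`
on the first, and `D^{(n l)} t₁⁻¹ = D^{(n-1 l+1)}`. For the remaining term, the shift `q⁻²` of the
spectral parameter matches the total weight of the other factors, which is fixed by the sector of
`G`.

In axiom 3, `t₁⁻¹ ⊗ t₁⁻¹` fixes `u_σ`, and at the pole `f₁` kills it, so the identity part of the
residue gives `(f₁ G') ⊗ u_σ`. In the other part `f₁` passes `D_N` at the cost of rescaling the last
parameter by `q^(l-n)`, and the string of `S` brings factor `N-1` to the front of the order
(`lowerOp_mul_sString`). There the two terms acting on `u_σ` cancel again, while the others leave a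
`t₁⁻¹` on factor `N`, which turns `D^{(n l)}` into `D^{(n-1 l+1)}` (`tensorF1_mulVec_residue`). -/

/-! ### Components and weights of the action of `f₁` -/

/-- The action of `f₁` on the tensor factors ordered by the rank function `ρ`: the operator
`f₁` in the factor `j` is accompanied by `t₁⁻¹` in all factors of higher rank. -/
def lowerOp {N : ℕ} (q : ℂ) (ρ : Fin N → ℕ) (ζ : Fin N → ℂ) : Op N :=
  ∑ j, tensorOp fun i => if i = j then vecF1 (ζ j) else if ρ j < ρ i then vecT1inv q else 1

theorem tensorF1_eq_lowerOp {N : ℕ} (q : ℂ) (ζ : Fin N → ℂ) :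
    tensorF1 q ζ = lowerOp q Fin.val ζ := by
  unfold tensorF1 lowerOp
  congr! 3 with j - i
  rcases lt_trichotomy i j with h | h | h
  · simp [h, h.ne, not_lt.mpr h.le]
  · simp [h]
  · simp [h, h.ne', not_lt.mpr h.le]

/-- The diagonal entries of `π(t₁⁻¹)`. -/
def tInv (q : ℂ) (a : Fin 2) : ℂ := if a = 0 then q⁻¹ else q

theorem vecT1inv_eq_diagonal (q : ℂ) : vecT1inv q = Matrix.diagonal (tInv q) := by
  ext a b
  fin_cases a <;> fin_cases b <;> simp [vecT1inv, tInv]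

theorem tInv_eq_zpow (q : ℂ) (a : Fin 2) : tInv q a = q ^ (-spin a) := by
  fin_cases a <;> simp [tInv, spin]

theorem prod_tInv {ι : Type*} {q : ℂ} (hq : q ≠ 0) (I : Finset ι) (s : ι → Fin 2) :
    ∏ i ∈ I, tInv q (s i) = q ^ (-∑ i ∈ I, spin (s i)) := by
  classical
  induction I using Finset.induction_on with
  | empty => simp
  | insert a I ha ih =>
    rw [Finset.prod_insert ha, Finset.sum_insert ha, ih, tInv_eq_zpow, ← zpow_add₀ hq]
    congr 1
    ring

/-- `t₁⁻¹` is diagonal and `f₁` only sends `+` to `-`, so each summand has a single contributing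
input state. -/
theorem lowerOp_mulVec_apply {N : ℕ} (q : ℂ) (ρ : Fin N → ℕ) (ζ : Fin N → ℂ) (v : State N)
    (s : Fin N → Fin 2) :
    (lowerOp q ρ ζ).mulVec v s =
      ∑ j, (if s j = 1 then (ζ j)⁻¹ else 0) *
        (∏ i, if ρ j < ρ i then tInv q (s i) else 1) * v (update s j 0) := by
  unfold lowerOp
  rw [Matrix.sum_mulVec, Finset.sum_apply]
  refine Finset.sum_congr rfl fun j _ => ?_
  rw [Matrix.mulVec, dotProduct, Finset.sum_eq_single (update s j 0)]
  · congr 1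
    unfold tensorOp
    rw [← Finset.mul_prod_erase _ _ (Finset.mem_univ j),
      ← Finset.mul_prod_erase (s := Finset.univ)
        (f := fun i => if ρ j < ρ i then tInv q (s i) else 1) (a := j) (Finset.mem_univ j)]
    have h : vecF1 (ζ j) (s j) 0 = if s j = 1 then (ζ j)⁻¹ else 0 := by
      generalize s j = a
      fin_cases a <;> simp [vecF1]
    simp only [if_true, update_self, h, lt_irrefl, if_false, one_mul]
    congr 1
    refine Finset.prod_congr rfl fun i hi => ?_
    have hij : i ≠ j := Finset.ne_of_mem_erase hi
    simp only [hij, if_false, update_of_ne hij, vecT1inv_eq_diagonal]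
    split_ifs <;> simp
  · intro t _ ht
    obtain ⟨i, hi⟩ := Function.ne_iff.mp ht
    rw [tensorOp, Finset.prod_eq_zero (Finset.mem_univ i), zero_mul]
    by_cases hij : i = j
    · subst hij
      have : t i = 1 := by
        simp only [update_self] at hi
        omega
      simp only [if_true, this, vecF1]
      generalize s i = a
      fin_cases a <;> simp
    · rw [update_of_ne hij] at hi
      simp only [hij, if_false, vecT1inv_eq_diagonal]
      split_ifs
      · exact Matrix.diagonal_apply_ne _ (Ne.symm hi)
      · exact Matrix.one_apply_ne (Ne.symm hi)
  · simp

theorem sum_spin_update {N : ℕ} (s : Fin N → Fin 2) {j : Fin N} (hj : s j = 1) :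
    ∑ i, spin (update s j 0 i) = ∑ i, spin (s i) + 2 := by
  rw [← Finset.add_sum_erase _ _ (Finset.mem_univ j),
    ← Finset.add_sum_erase (s := Finset.univ) (f := fun i => spin (s i)) (a := j)
      (Finset.mem_univ j), Finset.sum_congr rfl fun i hi => by
        rw [update_of_ne (Finset.ne_of_mem_erase hi)]]
  simp [hj, spin]
  ring

/-- Lowering one spin changes the total by `-2`. A sector depends on `n`, `l` only through `l - n`,
hence the form of `h`. -/
theorem tensorF1_mulVec_mem_sector {N : ℕ} (q : ℂ) (ζ : Fin N → ℂ) {v : State N}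
    {n l n' l' : ℤ} (hv : v ∈ sector N n l) (h : l' - n' = l - n - 2) :
    (tensorF1 q ζ).mulVec v ∈ sector N n' l' := by
  intro s hs
  rw [tensorF1_eq_lowerOp, lowerOp_mulVec_apply]
  refine Finset.sum_eq_zero fun j _ => ?_
  by_cases hj : s j = 1
  · rw [hv (update s j 0), mul_zero]
    rw [sum_spin_update s hj]
    omega
  · simp [hj]

/-! ### Exchanging two adjacent factors by the `S`-matrix -/

/-- The operator `∏ A i` outside of the tensor factors `j`, `k`, where it is `Y`. -/
def mixedOp {N : ℕ} (j k : Fin N) (A : Fin N → Matrix (Fin 2) (Fin 2) ℂ)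
    (Y : Matrix (Fin 2 × Fin 2) (Fin 2 × Fin 2) ℂ) : Op N :=
  fun s t => (∏ i ∈ (Finset.univ.erase j).erase k, A i (s i) (t i)) * Y (s j, s k) (t j, t k)

theorem mixedOp_congr {N : ℕ} {j k : Fin N} {A B : Fin N → Matrix (Fin 2) (Fin 2) ℂ}
    {Y Z : Matrix (Fin 2 × Fin 2) (Fin 2 × Fin 2) ℂ}
    (h : ∀ i, i ≠ j → i ≠ k → A i = B i) (hY : Y = Z) : mixedOp j k A Y = mixedOp j k B Z := by
  subst hY
  ext s t
  unfold mixedOp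
  congr 1
  refine Finset.prod_congr rfl fun i hi => ?_
  rw [h i (by aesop) (by aesop)]

theorem mixedOp_add {N : ℕ} (j k : Fin N) (A : Fin N → Matrix (Fin 2) (Fin 2) ℂ)
    (Y Z : Matrix (Fin 2 × Fin 2) (Fin 2 × Fin 2) ℂ) :
    mixedOp j k A (Y + Z) = mixedOp j k A Y + mixedOp j k A Z := by
  ext s t
  simp [mixedOp, mul_add]

/-- Reduces the matrix products with `pairOp` to products of 4 × 4 matrices. -/
theorem sum_agree {N : ℕ} {j k : Fin N} (hjk : j ≠ k) (s : Fin N → Fin 2)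
    (f : (Fin N → Fin 2) → ℂ) :
    (∑ u, if ∀ i, i ≠ j → i ≠ k → s i = u i then f u else 0) =
      ∑ p : Fin 2 × Fin 2, f (update (update s j p.1) k p.2) := by
  rw [← Finset.sum_filter]
  refine Finset.sum_nbij' (fun u => (u j, u k)) (fun p => update (update s j p.1) k p.2)
    (by simp) ?_ ?_ ?_ ?_
  · intro p _
    simp only [Finset.mem_filter, Finset.mem_univ, true_and]
    intro i hij hik
    rw [update_of_ne hik, update_of_ne hij]
  · intro u hu
    simp only [Finset.mem_filter, Finset.mem_univ, true_and] at hu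
    ext1 i
    by_cases hik : i = k
    · subst hik; simp
    by_cases hij : i = j
    · subst hij; simp [update_of_ne hik]
    rw [update_of_ne hik, update_of_ne hij, hu i hij hik]
  · intro p _
    ext1 <;> simp [update_of_ne hjk]
  · intro u hu
    simp only [Finset.mem_filter, Finset.mem_univ, true_and] at hu
    congr 1
    ext1 i
    by_cases hik : i = k
    · subst hik; simp
    by_cases hij : i = j
    · subst hij; simp [update_of_ne hik]
    rw [update_of_ne hik, update_of_ne hij, hu i hij hik]

theorem prod_split {N : ℕ} {j k : Fin N} (hjk : j ≠ k) (f : Fin N → ℂ) :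
    ∏ i, f i = f j * f k * ∏ i ∈ (Finset.univ.erase j).erase k, f i := by
  rw [← Finset.mul_prod_erase _ _ (Finset.mem_univ j),
    ← Finset.mul_prod_erase (s := Finset.univ.erase j) (a := k) _ (by simp [hjk.symm]), mul_assoc]

theorem pairOp_mul_tensorOp {N : ℕ} {j k : Fin N} (hjk : j ≠ k)
    (X : Matrix (Fin 2 × Fin 2) (Fin 2 × Fin 2) ℂ) (A : Fin N → Matrix (Fin 2) (Fin 2) ℂ) :
    pairOp j k X * tensorOp A = mixedOp j k A (X * (A j ⊗ₖ A k)) := by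
  ext s t
  rw [Matrix.mul_apply]
  simp only [pairOp, ite_mul, zero_mul]
  rw [sum_agree hjk s fun u => X (s j, s k) (u j, u k) * tensorOp A u t]
  simp only [mixedOp, Matrix.mul_apply, Finset.mul_sum]
  refine Finset.sum_congr rfl fun p _ => ?_
  rw [tensorOp, prod_split hjk, Finset.prod_congr rfl fun i hi => by
    rw [update_of_ne (Finset.ne_of_mem_erase hi),
      update_of_ne (Finset.ne_of_mem_erase (Finset.mem_of_mem_erase hi))]]
  simp only [update_self, update_of_ne hjk, Matrix.kroneckerMap_apply]
  ring

theorem tensorOp_mul_pairOp {N : ℕ} {j k : Fin N} (hjk : j ≠ k)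
    (X : Matrix (Fin 2 × Fin 2) (Fin 2 × Fin 2) ℂ) (A : Fin N → Matrix (Fin 2) (Fin 2) ℂ) :
    tensorOp A * pairOp j k X = mixedOp j k A ((A j ⊗ₖ A k) * X) := by
  ext s t
  rw [Matrix.mul_apply]
  simp only [pairOp, mul_ite, mul_zero]
  simp only [fun u : Fin N → Fin 2 => forall_congr' fun i => imp_congr_right fun _ : i ≠ j =>
    imp_congr_right fun _ : i ≠ k => (eq_comm : u i = t i ↔ t i = u i)]
  rw [sum_agree hjk t fun u => tensorOp A s u * X (u j, u k) (t j, t k)]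
  simp only [mixedOp, Matrix.mul_apply, Finset.mul_sum]
  refine Finset.sum_congr rfl fun p _ => ?_
  rw [tensorOp, prod_split hjk, Finset.prod_congr rfl fun i hi => by
    rw [update_of_ne (Finset.ne_of_mem_erase hi),
      update_of_ne (Finset.ne_of_mem_erase (Finset.mem_of_mem_erase hi))]]
  simp only [update_self, update_of_ne hjk, Matrix.kroneckerMap_apply]
  ring

/-- The `R`-matrix conserves the weight of the pair; this holds even at its poles. -/
theorem sMatrix_mul_kronecker_vecT1inv (q : ℂ) (S₀ : ℂ → ℂ) (ζ : ℂ) :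
    sMatrix q S₀ ζ * (vecT1inv q ⊗ₖ vecT1inv q) =
      (vecT1inv q ⊗ₖ vecT1inv q) * sMatrix q S₀ ζ := by
  rw [vecT1inv_eq_diagonal, Matrix.diagonal_kronecker_diagonal]
  ext ⟨a, b⟩ ⟨c, d⟩
  rw [Matrix.mul_diagonal, Matrix.diagonal_mul]
  fin_cases a <;> fin_cases b <;> fin_cases c <;> fin_cases d <;>
    simp [sMatrix, rMatrix, tInv, mul_comm]

/-- This is `R Δ(f₁) = Δ'(f₁) R`, checked entry by entry. -/
theorem sMatrix_intertwines {q : ℂ} (hq : q ≠ 0) (S₀ : ℂ → ℂ) {z w : ℂ} (hz : z ≠ 0)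
    (hw : w ≠ 0) (h : 1 - q ^ 2 * (z / w) ^ 2 ≠ 0) :
    sMatrix q S₀ (z / w) * (vecF1 z ⊗ₖ vecT1inv q + 1 ⊗ₖ vecF1 w) =
      (vecF1 z ⊗ₖ 1 + vecT1inv q ⊗ₖ vecF1 w) * sMatrix q S₀ (z / w) := by
  rw [sMatrix, Matrix.smul_mul, Matrix.mul_smul]
  congr 1
  have h' : w ^ 2 - q ^ 2 * z ^ 2 ≠ 0 := by
    intro h0
    apply h
    field_simp
    rw [h0, mul_zero]
  have e1 : q * (1 - (z / w) ^ 2) / (1 - q ^ 2 * (z / w) ^ 2) =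
      q * (w ^ 2 - z ^ 2) / (w ^ 2 - q ^ 2 * z ^ 2) := by
    field_simp
  have e2 : (1 - q ^ 2) * (z / w) / (1 - q ^ 2 * (z / w) ^ 2) =
      (1 - q ^ 2) * z * w / (w ^ 2 - q ^ 2 * z ^ 2) := by
    field_simp
  -- The common denominator is made an atom, and expanded only in the entries that need it.
  obtain ⟨e, he⟩ : ∃ e, e = w ^ 2 - q ^ 2 * z ^ 2 := ⟨_, rfl⟩
  rw [← he] at e1 e2 h'
  ext ⟨a, b⟩ ⟨c, d⟩
  fin_cases a <;> fin_cases b <;> fin_cases c <;> fin_cases d <;>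
    simp [Matrix.mul_apply, Fintype.sum_prod_type, rMatrix, vecF1, vecT1inv,
      Matrix.one_apply, e1, e2] <;>
    field_simp <;> first | ring1 | (rw [he]; ring1)

/-- The two terms with `f₁` in `j` or `k` combine into the intertwining relation. By `h3` no other
factor lies between `j` and `k`, so in the remaining terms the pair carries `1 ⊗ 1` or `t₁⁻¹ ⊗
t₁⁻¹`, both commuting with `S`. -/
theorem pairOp_mul_lowerOp {N : ℕ} {q : ℂ} (hq : q ≠ 0) (S₀ : ℂ → ℂ) {ζ : Fin N → ℂ}
    {j k : Fin N} {ρ ρ' : Fin N → ℕ} (hj : ζ j ≠ 0) (hk : ζ k ≠ 0)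
    (h : 1 - q ^ 2 * (ζ j / ζ k) ^ 2 ≠ 0) (h1 : ρ j < ρ k) (h2 : ρ' k < ρ' j)
    (h3 : ∀ i, i ≠ j → i ≠ k → ρ' i = ρ i ∧
      (ρ i < ρ j ∧ ρ i < ρ' k ∨ ρ k < ρ i ∧ ρ' j < ρ i)) :
    pairOp j k (sMatrix q S₀ (ζ j / ζ k)) * lowerOp q ρ ζ =
      lowerOp q ρ' ζ * pairOp j k (sMatrix q S₀ (ζ j / ζ k)) := by
  have hjk : j ≠ k := by rintro rfl; omega
  unfold lowerOp
  rw [Finset.mul_sum, Finset.sum_mul]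
  simp only [pairOp_mul_tensorOp hjk, tensorOp_mul_pairOp hjk]
  have split : ∀ f : Fin N → Op N,
      ∑ i, f i = (f j + f k) + ∑ i ∈ (Finset.univ.erase j).erase k, f i := by
    intro f
    rw [← Finset.add_sum_erase _ _ (Finset.mem_univ j),
      ← Finset.add_sum_erase (s := Finset.univ.erase j) (a := k) _ (by simp [hjk.symm]), add_assoc]
  rw [split, split]
  congr 1
  · simp only [hjk, hjk.symm, if_true, if_false, h1, h2, not_lt.mpr h1.le, not_lt.mpr h2.le]
    set A : Fin N → Matrix (Fin 2) (Fin 2) ℂ := fun i => if ρ j < ρ i then vecT1inv q else 1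
    have key := congrArg (mixedOp j k A) (sMatrix_intertwines hq S₀ hj hk h)
    rw [mul_add, add_mul, mixedOp_add, mixedOp_add] at key
    convert key using 2 <;>
    · refine mixedOp_congr (fun i hij hik => ?_) rfl
      have := h3 i hij hik
      simp only [hij, hik, if_false, A] <;> split_ifs <;> first | rfl | omega
  · refine Finset.sum_congr rfl fun i hi => mixedOp_congr ?_ ?_
    · intro m hmj hmk
      have hik : i ≠ k := Finset.ne_of_mem_erase hi
      have hij : i ≠ j := Finset.ne_of_mem_erase (Finset.mem_of_mem_erase hi)
      rw [(h3 i hij hik).1, (h3 m hmj hmk).1]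
    · have hik : i ≠ k := Finset.ne_of_mem_erase hi
      have hij : i ≠ j := Finset.ne_of_mem_erase (Finset.mem_of_mem_erase hi)
      obtain ⟨h4, h5⟩ := h3 i hij hik
      simp only [hij.symm, hik.symm, if_false]
      rcases h5 with h5 | h5
      · rw [if_pos h5.1, if_pos (by omega), if_pos (by omega), if_pos (by omega)]
        exact sMatrix_mul_kronecker_vecT1inv q S₀ _
      · rw [if_neg (by omega), if_neg (by omega), if_neg (by omega), if_neg (by omega)]
        simp

theorem swapState_lowerOp_mulVec {N : ℕ} (q : ℂ) (ρ : Fin N → ℕ) (ζ : Fin N → ℂ) (j k : Fin N)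
    (v : State N) :
    swapState j k ((lowerOp q ρ (ζ ∘ Equiv.swap j k)).mulVec v) =
      (lowerOp q (ρ ∘ Equiv.swap j k) ζ).mulVec (swapState j k v) := by
  ext s
  rw [swapState, lowerOp_mulVec_apply, lowerOp_mulVec_apply, ← Equiv.sum_comp (Equiv.swap j k)]
  refine Finset.sum_congr rfl fun m _ => ?_
  rw [← Equiv.prod_comp (Equiv.swap j k)]
  simp only [comp_apply, Equiv.swap_apply_self, swapState]
  congr 2
  ext i
  simp only [comp_apply, update_apply, Equiv.swap_apply_eq_iff]

/-! ### Deformed cyclicity -/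

theorem siteOp_diagonal_mulVec {N : ℕ} (j : Fin N) (d : Fin 2 → ℂ) (v : State N)
    (s : Fin N → Fin 2) : (siteOp j (Matrix.diagonal d)).mulVec v s = d (s j) * v s := by
  rw [Matrix.mulVec, dotProduct, Finset.sum_eq_single s]
  · congr 1
    rw [siteOp, tensorOp, Finset.prod_eq_single j]
    · simp
    · intro i _ hi
      simp [hi]
    · simp
  · intro t _ ht
    obtain ⟨i, hi⟩ := Function.ne_iff.mp ht
    rw [siteOp, tensorOp, Finset.prod_eq_zero (Finset.mem_univ i), zero_mul]
    split_ifs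
    · exact Matrix.diagonal_apply_ne _ (Ne.symm hi)
    · exact Matrix.one_apply_ne (Ne.symm hi)
  · simp

theorem diagD_eq_diagonal (q : ℂ) (n l : ℤ) :
    diagD q n l = Matrix.diagonal fun a => q ^ (-((n + l) / 2)) * q ^ (if a = 0 then n else l) := by
  ext a b
  fin_cases a <;> fin_cases b <;> simp [diagD]

@[simp] theorem shiftWith_castSucc {α : Type*} {N : ℕ} (a : Fin (N + 1) → α) (b : α) (i : Fin N) :
    shiftWith a b i.castSucc = a i.succ := by
  simp [shiftWith]

@[simp] theorem shiftWith_last {α : Type*} {N : ℕ} (a : Fin (N + 1) → α) (b : α) :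
    shiftWith a b (Fin.last N) = b := by
  simp [shiftWith]

theorem update_shiftWith_castSucc {α : Type*} {N : ℕ} (a : Fin (N + 1) → α) (i : Fin N) (c : α) :
    update (shiftWith a (a 0)) i.castSucc c =
      shiftWith (update a i.succ c) (update a i.succ c 0) := by
  ext m
  induction m using Fin.lastCases with
  | last => rw [update_of_ne (Fin.castSucc_lt_last i).ne']; simp [update_of_ne (Fin.succ_ne_zero i).symm]
  | cast m => simp [update_apply]

theorem update_shiftWith_last {α : Type*} {N : ℕ} (a : Fin (N + 1) → α) (c : α) :
    update (shiftWith a (a 0)) (Fin.last N) c = shiftWith (update a 0 c) (update a 0 c 0) := by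
  ext m
  induction m using Fin.lastCases with
  | last => simp
  | cast m => simp [(Fin.castSucc_lt_last m).ne]

theorem cycleState_tensorF1_mulVec {N : ℕ} (q b : ℂ) (ζ : Fin (N + 1) → ℂ) (v : State (N + 1))
    (s : Fin (N + 1) → Fin 2) :
    cycleState ((tensorF1 q (shiftWith ζ b)).mulVec v) s =
      (∑ i : Fin N, (if s i.succ = 1 then (ζ i.succ)⁻¹ else 0) *
        (∏ k : Fin N, if i < k then tInv q (s k.succ) else 1) * tInv q (s 0) *
          cycleState v (update s i.succ 0)) +
      (if s 0 = 1 then b⁻¹ else 0) * cycleState v (update s 0 0) := by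
  simp only [cycleState]
  rw [tensorF1_eq_lowerOp, lowerOp_mulVec_apply, Fin.sum_univ_castSucc]
  congr 1
  · refine Finset.sum_congr rfl fun i _ => ?_
    rw [Fin.prod_univ_castSucc, update_shiftWith_castSucc]
    simp [mul_assoc]
  · rw [update_shiftWith_last, Finset.prod_eq_one]
    · simp
    · intro k _
      simp [k.is_le]

theorem tensorF1_mulVec_apply_succ {N : ℕ} (q : ℂ) (ζ : Fin (N + 1) → ℂ) (v : State (N + 1))
    (s : Fin (N + 1) → Fin 2) :
    (tensorF1 q ζ).mulVec v s =
      (∑ i : Fin N, (if s i.succ = 1 then (ζ i.succ)⁻¹ else 0) *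
        (∏ k : Fin N, if i < k then tInv q (s k.succ) else 1) * v (update s i.succ 0)) +
      (if s 0 = 1 then (ζ 0)⁻¹ else 0) * (∏ k : Fin N, tInv q (s k.succ)) *
        v (update s 0 0) := by
  rw [tensorF1_eq_lowerOp, lowerOp_mulVec_apply, Fin.sum_univ_succ, add_comm]
  congr 1
  · refine Finset.sum_congr rfl fun i _ => ?_
    rw [Fin.prod_univ_succ]
    simp
  · rw [Fin.prod_univ_succ]
    simp

/-- Deformed cyclicity at one point is inherited by `π(f₁) v`. -/
theorem cycleState_tensorF1_of_cyclic {N : ℕ} {q : ℂ} (hq : q ≠ 0) {n l : ℤ} (c : ℂ)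
    (ζ : Fin (N + 1) → ℂ) {v w : State (N + 1)} (hw : w ∈ sector (N + 1) n l)
    (h : cycleState v = c • (siteOp 0 (diagD q n l)).mulVec w) :
    cycleState ((tensorF1 q (shiftWith ζ (ζ 0 * q ^ (-2 : ℤ)))).mulVec v) =
      c • (siteOp 0 (diagD q (n - 1) (l + 1))).mulVec ((tensorF1 q ζ).mulVec w) := by
  ext s
  rw [cycleState_tensorF1_mulVec, h, diagD_eq_diagonal, diagD_eq_diagonal,
    show n - 1 + (l + 1) = n + l by ring]
  simp only [Pi.smul_apply, siteOp_diagonal_mulVec, tensorF1_mulVec_apply_succ, smul_eq_mul,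
    mul_add, Finset.mul_sum]
  congr 1
  · refine Finset.sum_congr rfl fun i _ => ?_
    -- The factor moved to the end receives `t₁⁻¹`, which shifts the exponents of `D`.
    have e : tInv q (s 0) * q ^ (if s 0 = 0 then n else l) =
        q ^ (if s 0 = 0 then n - 1 else l + 1) := by
      rw [tInv]
      split_ifs
      · rw [zpow_sub_one₀ hq, mul_comm]
      · rw [zpow_add_one₀ hq, mul_comm]
    rw [update_of_ne (Fin.succ_ne_zero i).symm, ← e]
    ring
  · by_cases hs : s 0 = 1
    · by_cases hw0 : w (update s 0 0) = 0
      · simp [hw0]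
      · have hsum : ∑ i, spin (update s 0 0 i) = l - n := by
          by_contra hne
          exact hw0 (hw _ hne)
        rw [sum_spin_update s hs, Fin.sum_univ_succ, hs] at hsum
        have hsum' : ∑ i : Fin N, spin (s i.succ) = l - n - 1 := by
          simp only [spin] at hsum ⊢
          simp at hsum
          omega
        -- On the right stand the inverse of the shift `q⁻²` and the entry of `D^{(n l)}` at `+`; on
        -- the left, the entry of `D^{(n-1 l+1)}` at `-` and `t₁⁻¹` on all the other factors.
        have e : q ^ (l + 1) * q ^ (-(l - n - 1)) = q ^ (2 : ℤ) * q ^ n := by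
          rw [← zpow_add₀ hq, ← zpow_add₀ hq]
          congr 1
          ring
        rw [prod_tInv hq, hsum', hs]
        simp only [if_true, update_self, one_ne_zero, if_false, mul_inv, zpow_neg q 2, inv_inv]
        linear_combination (-(ζ 0)⁻¹ * c * q ^ (-((n + l) / 2)) * w (update s 0 0)) * e
    · simp [hs]

/-! ### Moving `f₁` through `D_N` and the string of `S`-matrices -/

theorem tensorOp_mul {N : ℕ} (A B : Fin N → Matrix (Fin 2) (Fin 2) ℂ) :
    tensorOp A * tensorOp B = tensorOp fun i => A i * B i := by
  ext s t
  simp only [Matrix.mul_apply, tensorOp, Finset.prod_univ_sum, Fintype.piFinset_univ,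
    Finset.prod_mul_distrib]

/-- A diagonal operator commutes with `t₁⁻¹`; its failure to commute with `f₁` is absorbed in the
parameter of factor `k`. -/
theorem lowerOp_mul_siteOp {N : ℕ} (q : ℂ) (ρ : Fin N → ℕ) {ζ ζ' : Fin N → ℂ} (k : Fin N)
    (d : Fin 2 → ℂ) (h : ∀ i, i ≠ k → ζ i = ζ' i)
    (hd : vecF1 (ζ k) * Matrix.diagonal d = Matrix.diagonal d * vecF1 (ζ' k)) :
    lowerOp q ρ ζ * siteOp k (Matrix.diagonal d) =
      siteOp k (Matrix.diagonal d) * lowerOp q ρ ζ' := by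
  unfold lowerOp siteOp
  rw [Finset.mul_sum, Finset.sum_mul]
  refine Finset.sum_congr rfl fun j _ => ?_
  rw [tensorOp_mul, tensorOp_mul]
  congr 1
  ext1 i
  by_cases hik : i = k
  · subst hik
    by_cases hij : i = j
    · subst hij
      simpa using hd
    · simp only [hij, if_false, if_true, vecT1inv_eq_diagonal]
      split_ifs
      · simp only [Matrix.diagonal_mul_diagonal, mul_comm]
      · simp
  · simp only [hik, if_false, mul_one, one_mul]
    by_cases hij : i = j
    · subst hij
      rw [h i hik]
    · simp [hij]

theorem siteOp_mul_pairOp {N : ℕ} {i j k : Fin N} (hij : i ≠ j) (hik : i ≠ k) (hjk : j ≠ k)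
    (A : Matrix (Fin 2) (Fin 2) ℂ) (X : Matrix (Fin 2 × Fin 2) (Fin 2 × Fin 2) ℂ) :
    siteOp i A * pairOp j k X = pairOp j k X * siteOp i A := by
  rw [siteOp, tensorOp_mul_pairOp hjk, pairOp_mul_tensorOp hjk]
  simp [hij.symm, hik.symm]

theorem lowerOp_congr {N : ℕ} (q : ℂ) {ρ ρ' : Fin N → ℕ} (ζ : Fin N → ℂ)
    (h : ∀ i j, ρ i < ρ j ↔ ρ' i < ρ' j) : lowerOp q ρ ζ = lowerOp q ρ' ζ := by
  simp only [lowerOp, h]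

theorem mul_ofFn_reverse_prod {R : Type*} [Monoid R] {M : ℕ} (g : Fin M → R) (T : ℕ → R)
    (h : ∀ k : Fin M, g k * T k = T (k + 1) * g k) :
    T M * (List.ofFn g).reverse.prod = (List.ofFn g).reverse.prod * T 0 := by
  induction M generalizing T with
  | zero => simp
  | succ M ih =>
    have h0 := h 0
    simp only [Fin.val_zero, zero_add] at h0
    rw [List.ofFn_succ, List.reverse_cons, List.prod_append, List.prod_singleton, ← mul_assoc,
      ih (fun i => g i.succ) (fun m => T (m + 1)) (fun k => h k.succ), mul_assoc, mul_assoc, h0]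

/-- The ranks of the tensor factors if the penultimate one is moved behind the first `m`. -/
def pulledRank (M m : ℕ) (i : Fin (M + 2)) : ℕ := if i = penult M then 2 * m else 2 * i + 1

theorem penult_val (M : ℕ) : (penult M : ℕ) = M := rfl

/-- Each `S` in the string moves factor `N-1` past one neighbour. Its even rank `2 * m` falls
between the odd ranks of the others, so every stage is an adjacent exchange. -/
theorem lowerOp_mul_sString {M : ℕ} {q : ℂ} (hq : q ≠ 0) (S₀ : ℂ → ℂ) {ζ : Fin (M + 1) → ℂ}
    (w : ℂ) (h0 : ∀ i, ζ i ≠ 0) (h1 : ∀ i j, i ≠ j → 1 - q ^ 2 * (ζ i / ζ j) ^ 2 ≠ 0) :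
    lowerOp q Fin.val (Fin.snoc (α := fun _ => ℂ) ζ w) * sString q S₀ ζ =
      sString q S₀ ζ * lowerOp q (pulledRank M 0) (Fin.snoc (α := fun _ => ℂ) ζ w) := by
  have hρ : lowerOp q Fin.val (Fin.snoc (α := fun _ => ℂ) ζ w) =
      lowerOp q (pulledRank M M) (Fin.snoc (α := fun _ => ℂ) ζ w) := by
    refine lowerOp_congr q _ fun i j => ?_
    simp only [pulledRank, Fin.ext_iff, penult_val]
    split_ifs <;> omega
  rw [hρ, sString]
  refine mul_ofFn_reverse_prod _
    (fun m => lowerOp q (pulledRank M m) (Fin.snoc (α := fun _ => ℂ) ζ w)) fun k => ?_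
  have e1 : Fin.snoc (α := fun _ => ℂ) ζ w (penult M) = ζ (Fin.last M) := by simp [penult]
  have e2 : Fin.snoc (α := fun _ => ℂ) ζ w k.castSucc.castSucc = ζ k.castSucc := by simp
  have hk := k.isLt
  have key := pairOp_mul_lowerOp hq S₀ (ζ := Fin.snoc (α := fun _ => ℂ) ζ w)
    (j := penult M) (k := k.castSucc.castSucc) (ρ := pulledRank M k) (ρ' := pulledRank M (k + 1))
  rw [e1, e2] at key
  refine key (h0 _) (h0 _) (h1 _ _ (Fin.castSucc_lt_last k).ne') ?_ ?_ ?_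
  · simp only [pulledRank, Fin.ext_iff, penult_val, Fin.val_castSucc]
    split_ifs <;> omega
  · simp only [pulledRank, Fin.ext_iff, penult_val, Fin.val_castSucc]
    split_ifs <;> omega
  · intro i hi hik
    simp only [pulledRank, Fin.ext_iff, penult_val, Fin.val_castSucc, ne_eq] at hi hik ⊢
    split_ifs <;> omega

theorem siteOp_last_mul_sString {M : ℕ} (q : ℂ) (S₀ : ℂ → ℂ) (ζ : Fin (M + 1) → ℂ)
    (A : Matrix (Fin 2) (Fin 2) ℂ) :
    siteOp (Fin.last (M + 1)) A * sString q S₀ ζ =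
      sString q S₀ ζ * siteOp (Fin.last (M + 1)) A := by
  refine mul_ofFn_reverse_prod _ (fun _ => siteOp (Fin.last (M + 1)) A) fun k => ?_
  have hk := k.isLt
  refine (siteOp_mul_pairOp ?_ ?_ ?_ _ _).symm <;>
  · simp only [ne_eq, Fin.ext_iff, penult_val, Fin.val_castSucc, Fin.val_last]
    omega

theorem update_castSucc_castSucc {α : Type*} {M : ℕ} (s : Fin (M + 2) → α) (k : Fin M) (c : α) :
    (fun i : Fin M => update s k.castSucc.castSucc c i.castSucc.castSucc) =
      update (fun i : Fin M => s i.castSucc.castSucc) k c := by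
  ext i
  simp [update_apply]

theorem lowerOp_mulVec_tensorU {M : ℕ} (q σ : ℂ) (ρ : Fin (M + 2) → ℕ) (Z : Fin (M + 2) → ℂ)
    (v : State M) (s : Fin (M + 2) → Fin 2) :
    (lowerOp q ρ Z).mulVec (tensorU v σ) s =
      (∑ k : Fin M, (if s k.castSucc.castSucc = 1 then (Z k.castSucc.castSucc)⁻¹ else 0) *
        ((∏ i : Fin M, if ρ k.castSucc.castSucc < ρ i.castSucc.castSucc then
            tInv q (s i.castSucc.castSucc) else 1) *
          (if ρ k.castSucc.castSucc < ρ (penult M) then tInv q (s (penult M)) else 1) *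
          (if ρ k.castSucc.castSucc < ρ (Fin.last (M + 1)) then
            tInv q (s (Fin.last (M + 1))) else 1)) *
        (v (update (fun i => s i.castSucc.castSucc) k 0) *
          uVec σ (s (penult M)) (s (Fin.last (M + 1))))) +
      (if s (penult M) = 1 then (Z (penult M))⁻¹ else 0) *
        ((∏ i : Fin M, if ρ (penult M) < ρ i.castSucc.castSucc then
            tInv q (s i.castSucc.castSucc) else 1) *
          (if ρ (penult M) < ρ (Fin.last (M + 1)) then tInv q (s (Fin.last (M + 1))) else 1)) *
        (v (fun i => s i.castSucc.castSucc) * uVec σ 0 (s (Fin.last (M + 1)))) +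
      (if s (Fin.last (M + 1)) = 1 then (Z (Fin.last (M + 1)))⁻¹ else 0) *
        ((∏ i : Fin M, if ρ (Fin.last (M + 1)) < ρ i.castSucc.castSucc then
            tInv q (s i.castSucc.castSucc) else 1) *
          (if ρ (Fin.last (M + 1)) < ρ (penult M) then tInv q (s (penult M)) else 1)) *
        (v (fun i => s i.castSucc.castSucc) * uVec σ (s (penult M)) 0) := by
  have h1 : (Fin.last M).castSucc ≠ Fin.last (M + 1) := (Fin.castSucc_lt_last _).ne
  have h2 : ∀ k : Fin M, k.castSucc.castSucc ≠ (Fin.last M).castSucc := fun k h =>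
    (Fin.castSucc_lt_last k).ne (Fin.castSucc_injective _ h)
  have h3 : ∀ k : Fin (M + 1), k.castSucc ≠ Fin.last (M + 1) := fun k => (Fin.castSucc_lt_last k).ne
  simp only [lowerOp_mulVec_apply, Fin.sum_univ_castSucc, Fin.prod_univ_castSucc, tensorU,
    update_castSucc_castSucc, penult, lt_irrefl, if_false, mul_one, update_self,
    update_of_ne h1, update_of_ne (h2 _), update_of_ne (h2 _).symm,
    update_of_ne (h3 _), update_of_ne (h3 _).symm]
  rfl

/-! ### Generic points -/

theorem dense_ne_zero_of_linearMap {N : ℕ} (L : (Fin N → ℂ) →ₗ[ℂ] ℂ) (hL : L ≠ 0) :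
    IsOpen {ζ | L ζ ≠ 0} ∧ Dense {ζ | L ζ ≠ 0} := by
  refine ⟨isOpen_ne.preimage L.continuous_of_finiteDimensional, ?_⟩
  have hc : {ζ | L ζ ≠ 0} = ((LinearMap.ker L : Submodule ℂ (Fin N → ℂ)) : Set (Fin N → ℂ))ᶜ := by
    ext
    simp
  rw [hc, ← interior_eq_empty_iff_dense_compl]
  by_contra hne
  exact hL (LinearMap.ker_eq_top.mp
    (Submodule.eq_top_of_nonempty_interior' _ (Set.nonempty_iff_ne_empty.mpr hne)))

theorem Generically.and_of_dense {N : ℕ} {P : (Fin N → ℂ) → Prop} (hP : Generically P)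
    {ι : Type*} [Finite ι] (L : ι → (Fin N → ℂ) →ₗ[ℂ] ℂ) (hL : ∀ a, L a ≠ 0) :
    Generically fun ζ => P ζ ∧ ∀ a, L a ζ ≠ 0 := by
  have ho : IsOpen {ζ | ∀ a, L a ζ ≠ 0} := by
    rw [Set.ofPred_forall]
    exact isOpen_iInter_of_finite fun a => (dense_ne_zero_of_linearMap (L a) (hL a)).1
  have hd : Dense {ζ | ∀ a, L a ζ ≠ 0} := by
    rw [Set.ofPred_forall]
    exact dense_iInter_of_isOpen (fun a => (dense_ne_zero_of_linearMap (L a) (hL a)).1)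
      fun a => (dense_ne_zero_of_linearMap (L a) (hL a)).2
  unfold Generically at hP ⊢
  rw [Set.ofPred_and, interior_inter, ho.interior_eq]
  exact hP.inter_of_isOpen_left hd isOpen_interior

theorem Generically.mono {N : ℕ} {P Q : (Fin N → ℂ) → Prop} (hP : Generically P)
    (h : ∀ ζ, P ζ → Q ζ) : Generically Q :=
  Dense.mono (interior_mono h) hP

/-- In a generic statement the variables may be assumed to be nonzero and to avoid the poles
of the `R`-matrix. -/
theorem Generically.of_regular {N : ℕ} {P Q : (Fin N → ℂ) → Prop} (hP : Generically P) (q : ℂ)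
    (h : ∀ ζ, (∀ i, ζ i ≠ 0) → (∀ i j, i ≠ j → 1 - q ^ 2 * (ζ i / ζ j) ^ 2 ≠ 0) → P ζ → Q ζ) :
    Generically Q := by
  -- The poles lie on the hyperplanes `ζ_j = c ζ_i` with `c = ±q`.
  have hpair : ∀ (c : ℂ) (p : {p : Fin N × Fin N // p.1 ≠ p.2}),
      (LinearMap.proj p.1.2 - c • LinearMap.proj p.1.1 : (Fin N → ℂ) →ₗ[ℂ] ℂ) ≠ 0 := by
    rintro c ⟨⟨i, j⟩, hij⟩ h0
    have := LinearMap.congr_fun h0 (Pi.single j 1)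
    simp [Pi.single_eq_of_ne hij] at this
  have hproj : ∀ i, (LinearMap.proj i : (Fin N → ℂ) →ₗ[ℂ] ℂ) ≠ 0 := by
    intro i h0
    have := LinearMap.congr_fun h0 (Pi.single i 1)
    simp at this
  refine (((hP.and_of_dense _ hproj).and_of_dense _ (hpair q)).and_of_dense _ (hpair (-q))).mono ?_
  rintro ζ ⟨⟨⟨hPζ, h1⟩, h2⟩, h3⟩
  simp only [LinearMap.proj_apply, LinearMap.sub_apply, LinearMap.smul_apply, smul_eq_mul]
    at h1 h2 h3
  refine h ζ h1 (fun i j hij h0 => ?_) hPζ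
  have hj := h1 j
  field_simp at h0
  have h4 := mul_ne_zero (h2 ⟨(i, j), hij⟩) (h3 ⟨(i, j), hij⟩)
  apply h4
  linear_combination h0

/-! ### Analyticity, meromorphy and simple poles -/

theorem analyticAt_tensorF1 {N : ℕ} (q : ℂ) {ζ₀ : Fin N → ℂ} (h : ∀ i, ζ₀ i ≠ 0)
    (s t : Fin N → Fin 2) : AnalyticAt ℂ (fun ζ => tensorF1 q ζ s t) ζ₀ := by
  have hinv : ∀ j, AnalyticAt ℂ (fun ζ : Fin N → ℂ => (ζ j)⁻¹) ζ₀ := fun j =>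
    ((ContinuousLinearMap.proj (R := ℂ) (φ := fun _ : Fin N => ℂ) j).analyticAt ζ₀).inv (h j)
  simp only [tensorF1, Matrix.sum_apply, tensorOp]
  refine Finset.analyticAt_fun_sum _ fun j _ => Finset.analyticAt_fun_prod _ fun i _ => ?_
  split_ifs
  · exact analyticAt_const
  · generalize s i = a, t i = b
    fin_cases a <;> fin_cases b <;>
      first
      | exact analyticAt_const
      | exact hinv j
  · exact analyticAt_const

theorem AnalyticAt.tensorF1_mulVec {N : ℕ} {E : Type*} [NormedAddCommGroup E] [NormedSpace ℂ E]
    (q : ℂ) {Z : E → Fin N → ℂ} {g : E → State N} {a : E} (hZ : AnalyticAt ℂ Z a)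
    (h : ∀ i, Z a i ≠ 0) (hg : AnalyticAt ℂ g a) :
    AnalyticAt ℂ (fun e => (tensorF1 q (Z e)).mulVec (g e)) a := by
  rw [analyticAt_pi_iff] at hg ⊢
  intro s
  simp only [Matrix.mulVec, dotProduct]
  exact Finset.analyticAt_fun_sum _ fun t _ =>
    ((analyticAt_tensorF1 q h s t).fun_comp hZ).mul (hg t)

theorem MeromorphicOnTorus.actF1 {N : ℕ} (q : ℂ) {G : (Fin N → ℂ) → State N}
    (hG : MeromorphicOnTorus G) : MeromorphicOnTorus (actF1 q G) := by
  intro ζ₀ h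
  obtain ⟨A, B, hA, hB, hB0, hAB⟩ := hG ζ₀ h
  refine ⟨fun ζ => (tensorF1 q ζ).mulVec (A ζ), B,
    AnalyticAt.tensorF1_mulVec q analyticAt_id h hA, hB, hB0, ?_⟩
  filter_upwards [hAB] with ζ hζ hne
  rw [← hζ hne, Matrix.mulVec_smul, XXZ.actF1]

theorem HasSimplePole.tensorF1_mulVec {N : ℕ} (q : ℂ) {Z : ℂ → Fin N → ℂ} {f : ℂ → State N}
    {a : ℂ} {R : State N} (hf : HasSimplePole f a R) (hZ : AnalyticAt ℂ Z a)
    (h : ∀ i, Z a i ≠ 0) :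
    HasSimplePole (fun w => (tensorF1 q (Z w)).mulVec (f w)) a ((tensorF1 q (Z a)).mulVec R) := by
  obtain ⟨⟨n, hn⟩, hlim⟩ := hf
  refine ⟨⟨n, ?_⟩, ?_⟩
  · simp only [← Matrix.mulVec_smul]
    exact AnalyticAt.tensorF1_mulVec q hZ h hn
  · simp only [← Matrix.mulVec_smul]
    rw [tendsto_pi_nhds] at hlim ⊢
    intro s
    simp only [Matrix.mulVec, dotProduct]
    exact tendsto_finsetSum _ fun t _ =>
      (((analyticAt_tensorF1 q h s t).fun_comp hZ).continuousAt.tendsto.mono_left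
        nhdsWithin_le_nhds).mul (hlim t)

theorem analyticAt_snoc {N : ℕ} (ζ : Fin N → ℂ) (a : ℂ) :
    AnalyticAt ℂ (fun w => Fin.snoc (α := fun _ => ℂ) ζ w) a := by
  rw [analyticAt_pi_iff]
  intro i
  induction i using Fin.lastCases with
  | last =>
    simp only [Fin.snoc_last]
    exact analyticAt_id
  | cast i => simpa using analyticAt_const

/-! ### The action of `f₁` on residues -/

/-- The hypothesis `h` is the vanishing of `f₁ u_σ`, whose only component is along `v₋ ⊗ v₋`. -/
theorem tensorF1_mulVec_tensorU {M : ℕ} {q : ℂ} (hq : q ≠ 0) {σ w : ℂ} {ζ : Fin (M + 1) → ℂ}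
    (h : σ * w⁻¹ + q * (ζ (Fin.last M))⁻¹ = 0) (v : State M) :
    (tensorF1 q (Fin.snoc (α := fun _ => ℂ) ζ w)).mulVec (tensorU v σ) =
      tensorU ((tensorF1 q fun k => ζ k.castSucc).mulVec v) σ := by
  ext s
  rw [tensorF1_eq_lowerOp, lowerOp_mulVec_tensorU, tensorU, tensorF1_eq_lowerOp,
    lowerOp_mulVec_apply, Finset.sum_mul, add_assoc]
  change _ = (∑ k : Fin M, _ * uVec σ (s (penult M)) (s (Fin.last (M + 1))))
  have hp' : ∀ k : Fin M, ¬ M < (k : ℕ) := fun k => k.isLt.not_gt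
  have hp'' : ∀ k : Fin M, ¬ M + 1 < (k : ℕ) := fun k => by have := k.isLt; omega
  have e1 : Fin.snoc (α := fun _ => ℂ) ζ w (penult M) = ζ (Fin.last M) := by simp [penult]
  rw [add_eq_left.mpr]
  · refine Finset.sum_congr rfl fun k _ => ?_
    have hk := k.isLt
    simp only [Fin.snoc_castSucc, Fin.val_castSucc, penult_val, Fin.val_last, hk,
      Nat.lt_succ_of_lt hk, if_true, Fin.val_fin_lt]
    generalize s (penult M) = a, s (Fin.last (M + 1)) = b
    fin_cases a <;> fin_cases b <;> simp [uVec, tInv, hq, mul_assoc]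
  · rw [e1]
    simp only [Fin.snoc_last, Fin.val_castSucc, penult_val, Fin.val_last, hp', hp'', if_false,
      Finset.prod_const_one, Nat.lt_succ_self, if_true, Nat.not_succ_lt_self]
    generalize s (penult M) = a, s (Fin.last (M + 1)) = b
    fin_cases a <;> fin_cases b <;> simp [uVec, tInv]
    linear_combination (v fun i => s i.castSucc.castSucc) * h

/-- With factor `N-1` lowest in the order, `f₁` there comes with `t₁⁻¹` on all of `v`, which gives
`q^(n-l)`. The terms with `f₁` inside `v` put `t₁⁻¹` on factor `N` only. -/
theorem pulled_lowerOp_mulVec_tensorU {M : ℕ} {q : ℂ} (hq : q ≠ 0) {n l : ℤ} {σ w : ℂ}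
    {ζ : Fin (M + 1) → ℂ} (h : σ * w⁻¹ + q ^ (n - l) * q * (ζ (Fin.last M))⁻¹ = 0)
    {v : State M} (hv : v ∈ sector M n l) :
    (lowerOp q (pulledRank M 0) (Fin.snoc (α := fun _ => ℂ) ζ w)).mulVec (tensorU v σ) =
      (siteOp (Fin.last (M + 1)) (vecT1inv q)).mulVec
        (tensorU ((tensorF1 q fun k => ζ k.castSucc).mulVec v) σ) := by
  ext s
  rw [vecT1inv_eq_diagonal, siteOp_diagonal_mulVec, lowerOp_mulVec_tensorU, tensorU,
    tensorF1_eq_lowerOp, lowerOp_mulVec_apply, Finset.sum_mul, Finset.mul_sum, add_assoc]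
  change _ = (∑ k : Fin M, _ * (_ * uVec σ (s (penult M)) (s (Fin.last (M + 1)))))
  have r1 : pulledRank M 0 (penult M) = 0 := by simp [pulledRank]
  have r2 : pulledRank M 0 (Fin.last (M + 1)) = 2 * M + 3 := by
    rw [pulledRank, if_neg (by simp [Fin.ext_iff, penult_val]), Fin.val_last]
    ring
  have r3 : ∀ k : Fin M, pulledRank M 0 k.castSucc.castSucc = 2 * k + 1 := fun k => by
    rw [pulledRank, if_neg (by simp [Fin.ext_iff, penult_val, k.isLt.ne])]
    simp
  have e1 : Fin.snoc (α := fun _ => ℂ) ζ w (penult M) = ζ (Fin.last M) := by simp [penult]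
  rw [add_eq_left.mpr]
  · refine Finset.sum_congr rfl fun k _ => ?_
    have hk : 2 * (k : ℕ) + 1 < 2 * M + 3 := by have := k.isLt; omega
    have hlt : ∀ i : Fin M, 2 * (k : ℕ) + 1 < 2 * i + 1 ↔ (k : ℕ) < i := fun i => by omega
    simp only [Fin.snoc_castSucc, r1, r2, r3, hk, hlt, if_true, Nat.not_lt_zero, if_false]
    ring
  · have hgt : ∀ k : Fin M, ¬ 2 * M + 3 < 2 * (k : ℕ) + 1 := fun k => by have := k.isLt; omega
    rw [e1]
    simp only [Fin.snoc_last, r1, r2, r3, hgt, if_false, Finset.prod_const_one, if_true,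
      Nat.not_lt_zero, Nat.zero_lt_succ]
    rw [prod_tInv hq]
    by_cases hs : ∑ i : Fin M, spin (s i.castSucc.castSucc) = l - n
    · rw [hs, neg_sub]
      generalize s (penult M) = a, s (Fin.last (M + 1)) = b
      fin_cases a <;> fin_cases b <;> simp [uVec, tInv]
      linear_combination (v fun i => s i.castSucc.castSucc) * h
    · rw [hv _ hs]
      simp

theorem vecF1_mul_diagD {q : ℂ} (hq : q ≠ 0) (n l : ℤ) (w : ℂ) :
    vecF1 w * diagD q n l = diagD q n l * vecF1 (w * q ^ (l - n)) := by
  have e : q ^ n = q ^ l * (q ^ (l - n))⁻¹ := by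
    rw [← zpow_neg, ← zpow_add₀ hq]
    congr 1
    ring
  rw [diagD, Matrix.mul_smul, Matrix.smul_mul]
  congr 1
  ext a b
  fin_cases a <;> fin_cases b <;> simp [vecF1]
  rw [e]
  ring

theorem diagD_mul_vecT1inv {q : ℂ} (hq : q ≠ 0) (n l : ℤ) :
    diagD q n l * vecT1inv q = diagD q (n - 1) (l + 1) := by
  rw [diagD, diagD, show n - 1 + (l + 1) = n + l by ring, Matrix.smul_mul]
  congr 1
  ext a b
  fin_cases a <;> fin_cases b <;>
    simp [vecT1inv, zpow_sub_one₀ hq, zpow_add_one₀ hq]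

theorem siteOp_mul {N : ℕ} (j : Fin N) (A B : Matrix (Fin 2) (Fin 2) ℂ) :
    siteOp j A * siteOp j B = siteOp j (A * B) := by
  rw [siteOp, siteOp, tensorOp_mul, siteOp]
  congr 1
  ext1 i
  split_ifs <;> simp

/-- The action of `f₁` on the residues in the annihilation pole axiom. -/
theorem tensorF1_mulVec_residue {M : ℕ} {q : ℂ} (hq : q ≠ 0) (S₀ : ℂ → ℂ) {n l : ℤ}
    {σ : ℂ} (hσ : σ ^ 2 = 1) (c : ℂ) {ζ : Fin (M + 1) → ℂ} (h0 : ∀ i, ζ i ≠ 0)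
    (h1 : ∀ i j, i ≠ j → 1 - q ^ 2 * (ζ i / ζ j) ^ 2 ≠ 0) {v : State M}
    (hv : v ∈ sector M (n - 1) (l - 1)) :
    (tensorF1 q (Fin.snoc (α := fun _ => ℂ) ζ (σ * ζ (Fin.last M) * (-q)⁻¹))).mulVec
      ((1 / 2 : ℂ) • ((1 : Op (M + 2)) -
        c • (siteOp (Fin.last (M + 1)) (diagD q n l) * sString q S₀ ζ)).mulVec (tensorU v σ)) =
    (1 / 2 : ℂ) • ((1 : Op (M + 2)) -
      c • (siteOp (Fin.last (M + 1)) (diagD q (n - 1) (l + 1)) * sString q S₀ ζ)).mulVec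
        (tensorU ((tensorF1 q fun k => ζ k.castSucc).mulVec v) σ) := by
  have hσ0 : σ ≠ 0 := by
    rintro rfl
    norm_num at hσ
  set a := σ * ζ (Fin.last M) * (-q)⁻¹ with ha
  have hζ := h0 (Fin.last M)
  have hσa : σ * a⁻¹ + q * (ζ (Fin.last M))⁻¹ = 0 := by
    rw [ha]
    field_simp
    ring
  have hmove : tensorF1 q (Fin.snoc (α := fun _ => ℂ) ζ a) *
      (siteOp (Fin.last (M + 1)) (diagD q n l) * sString q S₀ ζ) =
      siteOp (Fin.last (M + 1)) (diagD q n l) * (sString q S₀ ζ *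
        lowerOp q (pulledRank M 0) (Fin.snoc (α := fun _ => ℂ) ζ (a * q ^ (l - n)))) := by
    rw [← lowerOp_mul_sString hq S₀ _ h0 h1, tensorF1_eq_lowerOp, ← mul_assoc, ← mul_assoc]
    congr 1
    have hD := vecF1_mul_diagD hq n l a
    rw [diagD_eq_diagonal] at hD ⊢
    refine lowerOp_mul_siteOp q _ _ _ (fun i hi => ?_) (by simpa using hD)
    induction i using Fin.lastCases with
    | last => exact absurd rfl hi
    | cast i => simp
  -- The rescaling caused by `D_N` is exactly what offsets the weight of `v`, so the cancellation is
  -- the one in `hσa`.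
  have hpull := pulled_lowerOp_mulVec_tensorU (n := n - 1) (l := l - 1) (σ := σ)
    (w := a * q ^ (l - n)) (ζ := ζ) hq (by
      rw [mul_inv, ← zpow_neg, neg_sub, show n - 1 - (l - 1) = n - l by ring]
      linear_combination q ^ (n - l) * hσa) hv
  rw [Matrix.mulVec_smul, Matrix.mulVec_mulVec, mul_sub, mul_one, mul_smul_comm, hmove]
  congr 1
  rw [Matrix.sub_mulVec, Matrix.sub_mulVec, Matrix.smul_mulVec, Matrix.smul_mulVec,
    Matrix.one_mulVec, tensorF1_mulVec_tensorU hq hσa, ← mul_assoc, ← Matrix.mulVec_mulVec,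
    hpull, Matrix.mulVec_mulVec, mul_assoc, ← siteOp_last_mul_sString, ← mul_assoc, siteOp_mul,
    diagD_mul_vecT1inv hq]

/-! ### Inheritance of the three axioms -/

theorem SMatrixSymmetry.actF1 {M : ℕ} {q : ℂ} (hq : q ≠ 0) {S₀ : ℂ → ℂ}
    {G : (Fin (M + 2) → ℂ) → State (M + 2)} (hG : SMatrixSymmetry q S₀ G) :
    SMatrixSymmetry q S₀ (actF1 q G) := by
  intro j
  refine (hG j).of_regular q fun ζ h0 h1 h => ?_
  have hne : j.castSucc ≠ j.succ := (Fin.castSucc_lt_succ).ne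
  simp only [XXZ.actF1, tensorF1_eq_lowerOp]
  rw [swapState_lowerOp_mulVec, h, Matrix.mulVec_mulVec, Matrix.mulVec_mulVec,
    pairOp_mul_lowerOp hq S₀ (h0 _) (h0 _) (h1 _ _ hne)
      (ρ' := Fin.val ∘ Equiv.swap j.castSucc j.succ)]
  · simp
  · simp
  · intro i hi hi'
    rw [comp_apply, comp_apply, comp_apply, Equiv.swap_apply_of_ne_of_ne hi hi',
      Equiv.swap_apply_left, Equiv.swap_apply_right]
    simp only [ne_eq, Fin.ext_iff] at hi hi'
    have hc : (j.castSucc : ℕ) = j := rfl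
    have hs : (j.succ : ℕ) = j + 1 := rfl
    omega

theorem DeformedCyclicity.actF1 {M : ℕ} {q : ℂ} (hq : q ≠ 0) {r : ℂ → ℂ} {ε : ℂ} {n l : ℤ}
    {G : (Fin (M + 2) → ℂ) → State (M + 2)} (hG : ∀ ζ, G ζ ∈ sector (M + 2) n l)
    (h : DeformedCyclicity q r ε (diagD q n l) G) :
    DeformedCyclicity q r ε (diagD q (n - 1) (l + 1)) (actF1 q G) :=
  Generically.mono h fun ζ hζ => cycleState_tensorF1_of_cyclic hq _ ζ (hG ζ) hζ

theorem AnnihilationPole.actF1 {M : ℕ} {q : ℂ} (hq : q ≠ 0) {S₀ r : ℂ → ℂ} {ε : ℂ} {n l : ℤ}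
    {G : (Fin (M + 2) → ℂ) → State (M + 2)} {G' : (Fin M → ℂ) → State M}
    (hG' : ∀ ζ, G' ζ ∈ sector M (n - 1) (l - 1))
    (h : AnnihilationPole q S₀ r ε (diagD q n l) G G') :
    AnnihilationPole q S₀ r ε (diagD q (n - 1) (l + 1)) (actF1 q G) (actF1 q G') := by
  intro σ hσ
  refine (h σ hσ).of_regular q fun ζ h0 h1 hpole => ?_
  have hσ2 : σ ^ 2 = 1 := by rcases hσ with rfl | rfl <;> norm_num
  have hσ0 : σ ≠ 0 := by rintro rfl; norm_num at hσ2
  have key := hpole.tensorF1_mulVec q (analyticAt_snoc ζ _) fun i => by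
    induction i using Fin.lastCases with
    | last => simpa [hσ0, hq] using h0 (Fin.last M)
    | cast i => simpa using h0 i
  rwa [tensorF1_mulVec_residue hq S₀ hσ2 _ h0 h1 (hG' _)] at key

end XXZ
end

theorem mainTheorem1 (q : ℝ) (hq₀ : -1 < q) (hq₁ : q < 0)
    (S₀ r : ℂ → ℂ) (ε : ℂ) (hε : ε = 1 ∨ ε = -1)
    (n l M : ℕ) (hnl : n ≤ l) (hN : n + l = M + 2) (heven : Even (n + l))
    (G : (Fin (M + 2) → ℂ) → XXZ.State (M + 2)) (G' : (Fin M → ℂ) → XXZ.State M)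
    (hG : ∀ ζ, G ζ ∈ XXZ.sector (M + 2) n l)
    (hG' : ∀ ζ, G' ζ ∈ XXZ.sector M (n - 1) (l - 1))
    (hform : XXZ.IsFormFactor (q : ℂ) S₀ r ε (XXZ.diagD q n l) G G') :
    (∀ ζ, XXZ.actF1 q G ζ ∈ XXZ.sector (M + 2) (n + 1) (l - 1)) ∧
    (∀ ζ, XXZ.actF1 q G' ζ ∈ XXZ.sector M n (l - 2)) ∧
    XXZ.IsFormFactor (q : ℂ) S₀ r ε (XXZ.diagD q (n - 1) (l + 1))
      (XXZ.actF1 q G) (XXZ.actF1 q G') := by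
  have hq : (q : ℂ) ≠ 0 := Complex.ofReal_ne_zero.mpr hq₁.ne
  refine ⟨fun ζ => XXZ.tensorF1_mulVec_mem_sector _ _ (hG ζ) (by ring),
    fun ζ => XXZ.tensorF1_mulVec_mem_sector _ _ (hG' ζ) (by ring), ?_⟩
  exact ⟨hform.meromorphic.actF1 _, hform.symmetry.actF1 hq, hform.cyclicity.actF1 hq hG,
    hform.poles.actF1 hq hG'⟩
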